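/- Let $K$ be a field, let $m,n,t\ge 1$ be integers and let $F\in GL_t(K)$. Let $H(F)$ be the universal cosovereign Hopf algebra: the $K$-algebra generated by $(u_{ij})_{1\le i,j\le t}$, $(v_{ij})_{1\le i,j\le t}$ subject to the relations $$u\,{}^t v={}^t v\,u=I_t=vF\,{}^t u\,F^{-1}=F\,{}^t u\,F^{-1}v,\qquad u=(u_{ij}),\ v=(v_{ij}),$$ with comultiplication $\Delta(u_{ij})=\sum_k u_{ik}\otimes u_{kj}$, $\Delta(v_{ij})=\sum_k v_{ik}\otimes v_{kj}$, counit $\varepsilon(u_{ij})=\varepsilon(v_{ij})=\delta_{ij}$, and antipode $S$ given by $S(u)={}^t v$, $S(v)=F\,{}^t u\,F^{-1}$. For $p,q\ge1$ let $A(p,q)$ be the free associative unital $K$-algebra on $pq$ generators; denote the generators of $A(m,n)$, $A(m,t)$, $A(t,n)$ by $x_{ij}$, $y_{ij}$, $z_{ij}$ respectively. Let $\rho:A(m,t)\to A(m,t)\otimes H(F)$ and $\lambda:A(t,n)\to H(F)\otimes A(t,n)$ be the algebra morphisms with $\rho(y_{ij})=\sum_{k=1}^t y_{ik}\otimes u_{kj}$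 and $\lambda(z_{ij})=\sum_{k=1}^t u_{ik}\otimes z_{kj}$; they make $A(m,t)$ a right and $A(t,n)$ a left $H(F)$-comodule algebra. Turn $A(m,t)$ into a left $H(F)$-comodule by $\rho'=\tau\circ(\mathrm{id}\otimes S)\circ\rho$, where $\tau$ is the flip, and give $A(m,t)\otimes A(t,n)$ the tensor product left comodule structure $\alpha$, that is, $\alpha(a\otimes b)=\sum a_{(-1)}b_{(-1)}\otimes(a_{(0)}\otimes b_{(0)})$ where $\rho'(a)=\sum a_{(-1)}\otimes a_{(0)}$ and $\lambda(b)=\sum b_{(-1)}\otimes b_{(0)}$. The coinvariants $$(A(m,t)\otimes A(t,n))^{\mathrm{co}\,H(F)}=\{x\mid \alpha(x)=1\otimes x\}$$ form a subalgebra of $A(m,t)\otimes A(t,n)$ (with its usual tensor product algebra structure). Then the algebra morphism $$\theta:A(m,n)\longrightarrow (A(m,t)\otimes A(t,n))^{\mathrm{co}\,H(F)},\qquad x_{ij}\longmapsto\sum_{k=1}^t y_{ik}\otimes z_{kj},$$ is well defined (its values are coinvariants) and is an isomorphism. -/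

import Mathlib

open scoped TensorProduct

noncomputable section

namespace FreeFFT

universe u

section Setup

variable {K : Type*} [Field K] {H : Type*} [Semiring H] [HopfAlgebra K H]

/-- The left comodule structure `τ ∘ (id ⊗ S) ∘ ρ` on a right comodule with coaction `ρ`. -/
def rightToLeft {A : Type*} [AddCommMonoid A] [Module K A] (ρ : A →ₗ[K] A ⊗[K] H) :
    A →ₗ[K] H ⊗[K] A :=
  (TensorProduct.comm K A H).toLinearMap ∘ₗ
    (HopfAlgebra.antipode K (A := H)).lTensor A ∘ₗ ρ

/-- The tensor product of two left comodules: `x ⊗ y ↦ x₍₋₁₎ y₍₋₁₎ ⊗ (x₍₀₎ ⊗ y₍₀₎)`. -/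
def tensorCoaction {M N : Type*} [AddCommMonoid M] [Module K M] [AddCommMonoid N] [Module K N]
    (α : M →ₗ[K] H ⊗[K] M) (β : N →ₗ[K] H ⊗[K] N) :
    M ⊗[K] N →ₗ[K] H ⊗[K] (M ⊗[K] N) :=
  (LinearMap.mul' K H).rTensor (M ⊗[K] N) ∘ₗ
    (TensorProduct.tensorTensorTensorComm K H M H N).toLinearMap ∘ₗ TensorProduct.map α β

/-- The coinvariants `{x | α x = 1 ⊗ x}` of a left comodule with coaction `α`. -/
def coinvariants {M : Type*} [AddCommMonoid M] [Module K M] (α : M →ₗ[K] H ⊗[K] M) :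
    Submodule K M :=
  LinearMap.eqLocus α (TensorProduct.mk K H M 1)

theorem mem_coinvariants {M : Type*} [AddCommMonoid M] [Module K M] (α : M →ₗ[K] H ⊗[K] M)
    (x : M) : x ∈ coinvariants α ↔ α x = 1 ⊗ₜ[K] x := Iff.rfl

variable {A B : Type*} [Semiring A] [Algebra K A] [Semiring B] [Algebra K B]

/-- The left coaction on `A ⊗ B`, for a right comodule algebra `(A, ρ)` and a left comodule
algebra `(B, l)`: `a ⊗ b ↦ S(a₍₁₎) b₍₋₁₎ ⊗ (a₍₀₎ ⊗ b₍₀₎)`. -/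
def pairCoaction (ρ : A →ₐ[K] A ⊗[K] H) (l : B →ₐ[K] H ⊗[K] B) :
    A ⊗[K] B →ₗ[K] H ⊗[K] (A ⊗[K] B) :=
  tensorCoaction (rightToLeft ρ.toLinearMap) l.toLinearMap

variable (K H A B) in
/-- The linear map `(a ⊗ h) ⊗ (g ⊗ b) ↦ S(h) g ⊗ (a ⊗ b)`, through which `pairCoaction` factors. -/
def pairAux : (A ⊗[K] H) ⊗[K] (H ⊗[K] B) →ₗ[K] H ⊗[K] (A ⊗[K] B) :=
  (LinearMap.mul' K H).rTensor (A ⊗[K] B) ∘ₗ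
    (TensorProduct.tensorTensorTensorComm K H A H B).toLinearMap ∘ₗ
    TensorProduct.map ((TensorProduct.comm K A H).toLinearMap ∘ₗ
      (HopfAlgebra.antipode K (A := H)).lTensor A) LinearMap.id

theorem pairAux_tmul (a : A) (h g : H) (b : B) :
    pairAux K H A B ((a ⊗ₜ h) ⊗ₜ (g ⊗ₜ b)) =
      (HopfAlgebra.antipode K h * g) ⊗ₜ (a ⊗ₜ b) := by
  simp [pairAux]

theorem pairCoaction_tmul (ρ : A →ₐ[K] A ⊗[K] H) (l : B →ₐ[K] H ⊗[K] B) (a : A) (b : B) :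
    pairCoaction ρ l (a ⊗ₜ b) = pairAux K H A B (ρ a ⊗ₜ l b) := rfl

theorem pairAux_mul (p' : A ⊗[K] H) (q' : H ⊗[K] B) :
    ∃ Φ : H ⊗[K] (A ⊗[K] B) →ₗ[K] H ⊗[K] (A ⊗[K] B),
      (∀ p q, pairAux K H A B ((p * p') ⊗ₜ (q * q')) = Φ (pairAux K H A B (p ⊗ₜ q))) ∧
      ∀ x, Φ (1 ⊗ₜ x) = (1 ⊗ₜ x) * pairAux K H A B (p' ⊗ₜ q') := by
  induction p' with
  | zero => exact ⟨0, by simp, by simp⟩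
  | add p₁ p₂ h₁ h₂ =>
    obtain ⟨Φ₁, h₁, k₁⟩ := h₁
    obtain ⟨Φ₂, h₂, k₂⟩ := h₂
    exact ⟨Φ₁ + Φ₂, by simp [mul_add, TensorProduct.add_tmul, h₁, h₂],
      by simp [mul_add, TensorProduct.add_tmul, k₁, k₂]⟩
  | tmul a' h' =>
    induction q' with
    | zero => exact ⟨0, by simp, by simp⟩
    | add q₁ q₂ h₁ h₂ =>
      obtain ⟨Φ₁, h₁, k₁⟩ := h₁
      obtain ⟨Φ₂, h₂, k₂⟩ := h₂
      exact ⟨Φ₁ + Φ₂, by simp [mul_add, TensorProduct.tmul_add, h₁, h₂],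
        by simp [mul_add, TensorProduct.tmul_add, k₁, k₂]⟩
    | tmul g' b' =>
      refine ⟨LinearMap.mulLeft K ((HopfAlgebra.antipode K h') ⊗ₜ (1 : A ⊗[K] B)) ∘ₗ
        LinearMap.mulRight K (g' ⊗ₜ (a' ⊗ₜ b')), fun p q => ?_, fun x => ?_⟩
      · induction p with
        | zero => simp
        | add p₁ p₂ h₁ h₂ => simp only [add_mul, TensorProduct.add_tmul, map_add, h₁, h₂]
        | tmul a h =>
          induction q with
          | zero => simp
          | add q₁ q₂ h₁ h₂ => simp only [add_mul, TensorProduct.tmul_add, map_add, h₁, h₂]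
          | tmul g b =>
            simp [pairAux_tmul, HopfAlgebra.antipode_mul_antidistrib, mul_assoc]
      · simp [pairAux_tmul]

theorem pairCoaction_mul (ρ : A →ₐ[K] A ⊗[K] H) (l : B →ₐ[K] H ⊗[K] B) (y : A ⊗[K] B) :
    ∃ Φ : H ⊗[K] (A ⊗[K] B) →ₗ[K] H ⊗[K] (A ⊗[K] B),
      (∀ x, pairCoaction ρ l (x * y) = Φ (pairCoaction ρ l x)) ∧
      ∀ x, Φ (1 ⊗ₜ x) = (1 ⊗ₜ x) * pairCoaction ρ l y := by
  induction y with
  | zero => exact ⟨0, by simp, by simp⟩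
  | add y₁ y₂ h₁ h₂ =>
    obtain ⟨Φ₁, h₁, k₁⟩ := h₁
    obtain ⟨Φ₂, h₂, k₂⟩ := h₂
    exact ⟨Φ₁ + Φ₂, by simp [mul_add, h₁, h₂], by simp [mul_add, k₁, k₂]⟩
  | tmul c d =>
    obtain ⟨Φ, h, k⟩ := pairAux_mul (ρ c) (l d)
    refine ⟨Φ, fun x => ?_, fun x => by rw [k, pairCoaction_tmul]⟩
    induction x with
    | zero => simp
    | add x₁ x₂ h₁ h₂ => simp only [add_mul, map_add, h₁, h₂]
    | tmul a b =>
      rw [Algebra.TensorProduct.tmul_mul_tmul, pairCoaction_tmul, pairCoaction_tmul, map_mul,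
        map_mul, h]

/-- The algebra `(A ⊗ B)^{co H}` of coinvariants of `A ⊗ B`, for a right comodule algebra `(A, ρ)`
and a left comodule algebra `(B, l)`. It is a subalgebra of the usual tensor product algebra. -/
def coinvariantAlgebra (ρ : A →ₐ[K] A ⊗[K] H) (l : B →ₐ[K] H ⊗[K] B) :
    Subalgebra K (A ⊗[K] B) :=
  (coinvariants (pairCoaction ρ l)).toSubalgebra
    (by
      rw [mem_coinvariants, Algebra.TensorProduct.one_def, pairCoaction_tmul, map_one, map_one,
        Algebra.TensorProduct.one_def, Algebra.TensorProduct.one_def, pairAux_tmul]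
      simp)
    (by
      intro x y hx hy
      rw [mem_coinvariants] at *
      obtain ⟨Φ, h, k⟩ := pairCoaction_mul ρ l y
      rw [h, hx, k, hy]
      simp)

theorem mem_coinvariantAlgebra (ρ : A →ₐ[K] A ⊗[K] H) (l : B →ₐ[K] H ⊗[K] B) (x : A ⊗[K] B) :
    x ∈ coinvariantAlgebra ρ l ↔ pairCoaction ρ l x = 1 ⊗ₜ[K] x := Iff.rfl

end Setup

section Theta

/-- `FreeMat K p q` is the free algebra `A(p,q)` on `pq` generators. -/
abbrev FreeMat (K : Type*) [Field K] (p q : ℕ) := FreeAlgebra K (Fin p × Fin q)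

variable (K : Type*) [Field K]

/-- The canonical generators of the free algebra `A(p,q)`. -/
def gen {p q : ℕ} (i : Fin p) (j : Fin q) : FreeMat K p q := FreeAlgebra.ι K (i, j)

/-- The algebra morphism `A(m,n) → A(m,t) ⊗ A(t,n)`, `x_ij ↦ ∑ₖ y_ik ⊗ z_kj`. -/
def theta (m n t : ℕ) : FreeMat K m n →ₐ[K] FreeMat K m t ⊗[K] FreeMat K t n :=
  FreeAlgebra.lift K fun p => ∑ k : Fin t, gen K p.1 k ⊗ₜ[K] gen K k p.2

variable {K} {H : Type*} [Semiring H] [HopfAlgebra K H] {t : ℕ}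

/-- A matrix over `H` is multiplicative if `Δ(u_ij) = ∑ₖ u_ik ⊗ u_kj` and `ε(u_ij) = δ_ij`. -/
structure IsMultiplicative (u : Matrix (Fin t) (Fin t) H) : Prop where
  comul_eq : ∀ i j, Coalgebra.comul (R := K) (u i j) = ∑ k, u i k ⊗ₜ[K] u k j
  counit_eq : ∀ i j, Coalgebra.counit (R := K) (u i j) = if i = j then 1 else 0

/-- The right coaction on `A(m,t)` given by `u`: `y_ij ↦ ∑ₖ y_ik ⊗ u_kj`. -/
def rightCoaction (m : ℕ) (u : Matrix (Fin t) (Fin t) H) :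
    FreeMat K m t →ₐ[K] FreeMat K m t ⊗[K] H :=
  FreeAlgebra.lift K fun p => ∑ k : Fin t, gen K p.1 k ⊗ₜ[K] u k p.2

/-- The left coaction on `A(t,n)` given by `u`: `z_ij ↦ ∑ₖ u_ik ⊗ z_kj`. -/
def leftCoaction (n : ℕ) (u : Matrix (Fin t) (Fin t) H) :
    FreeMat K t n →ₐ[K] H ⊗[K] FreeMat K t n :=
  FreeAlgebra.lift K fun p => ∑ k : Fin t, u p.1 k ⊗ₜ[K] gen K k p.2

/-- The image of `theta` consists of coinvariants, for every multiplicative matrix. -/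
theorem theta_mem (m n : ℕ) {u : Matrix (Fin t) (Fin t) H} (hu : IsMultiplicative (K := K) u)
    (x : FreeMat K m n) :
    theta K m n t x ∈ coinvariantAlgebra (rightCoaction m u) (leftCoaction n u) := by
  have hS : ∀ i j, ∑ k, HopfAlgebra.antipode K (u i k) * u k j = if i = j then 1 else 0 := by
    intro i j
    have h := HopfAlgebra.mul_antipode_rTensor_comul_apply (R := K) (u i j)
    rw [hu.comul_eq, hu.counit_eq] at h
    simp only [map_sum, LinearMap.rTensor_tmul, LinearMap.mul'_apply] at h
    rw [h]
    split_ifs <;> simp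
  induction x using FreeAlgebra.induction with
  | grade0 r => rw [AlgHom.commutes]; exact Subalgebra.algebraMap_mem _ r
  | mul a b ha hb => rw [map_mul]; exact mul_mem ha hb
  | add a b ha hb => rw [map_add]; exact add_mem ha hb
  | grade1 p =>
    obtain ⟨i, j⟩ := p
    rw [mem_coinvariantAlgebra]
    simp only [theta, FreeAlgebra.lift_ι_apply, map_sum, pairCoaction_tmul, rightCoaction,
      leftCoaction, gen, TensorProduct.sum_tmul, TensorProduct.tmul_sum, pairAux_tmul]
    rw [Finset.sum_comm]
    refine Finset.sum_congr rfl fun a _ => ?_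
    rw [Finset.sum_comm]
    simp only [← TensorProduct.sum_tmul, hS, TensorProduct.ite_tmul]
    simp

/-- The algebra morphism `θ : A(m,n) → (A(m,t) ⊗ A(t,n))^{co H}`. -/
def thetaCo (m n : ℕ) {u : Matrix (Fin t) (Fin t) H} (hu : IsMultiplicative (K := K) u) :
    FreeMat K m n →ₐ[K] coinvariantAlgebra (rightCoaction (K := K) m u) (leftCoaction n u) :=
  (theta K m n t).codRestrict _ (theta_mem m n hu)

end Theta

section Cosovereign

open Matrix

variable {K : Type u} [Field K] {t : ℕ}

/-- A scalar matrix, viewed as a matrix over an algebra. -/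
abbrev scal (B : Type*) [Semiring B] [Algebra K B] (M : Matrix (Fin t) (Fin t) K) :
    Matrix (Fin t) (Fin t) B := M.map (algebraMap K B)

/-- The relations `u ᵗv = ᵗv u = 1 = v F ᵗu F⁻¹ = F ᵗu F⁻¹ v` for two matrices over an algebra. -/
structure Relations (F : GL (Fin t) K) {B : Type*} [Semiring B] [Algebra K B]
    (u v : Matrix (Fin t) (Fin t) B) : Prop where
  uv : u * vᵀ = 1
  vu : vᵀ * u = 1
  vFu : v * scal B F.1 * uᵀ * scal B F⁻¹.1 = 1
  Fuv : scal B F.1 * uᵀ * scal B F⁻¹.1 * v = 1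

variable (K t) in
/-- The free algebra on the `2t²` generators `u_ij` (left summand) and `v_ij` (right summand). -/
abbrev FreeUV := FreeAlgebra K ((Fin t × Fin t) ⊕ (Fin t × Fin t))

variable (K t) in
/-- The matrix of the free generators `u_ij`. -/
def freeU : Matrix (Fin t) (Fin t) (FreeUV K t) :=
  Matrix.of fun i j => FreeAlgebra.ι K (Sum.inl (i, j))

variable (K t) in
/-- The matrix of the free generators `v_ij`. -/
def freeV : Matrix (Fin t) (Fin t) (FreeUV K t) :=
  Matrix.of fun i j => FreeAlgebra.ι K (Sum.inr (i, j))

/-- The entries of the defining relations `u ᵗv = ᵗv u = 1 = v F ᵗu F⁻¹ = F ᵗu F⁻¹ v`. -/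
inductive Rel (F : GL (Fin t) K) : FreeUV K t → FreeUV K t → Prop
  | uv (i j) : Rel F ((freeU K t * (freeV K t)ᵀ) i j)
      ((1 : Matrix (Fin t) (Fin t) (FreeUV K t)) i j)
  | vu (i j) : Rel F (((freeV K t)ᵀ * freeU K t) i j)
      ((1 : Matrix (Fin t) (Fin t) (FreeUV K t)) i j)
  | vFu (i j) : Rel F
      ((freeV K t * scal (FreeUV K t) F.1 * (freeU K t)ᵀ * scal (FreeUV K t) F⁻¹.1) i j)
      ((1 : Matrix (Fin t) (Fin t) (FreeUV K t)) i j)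
  | Fuv (i j) : Rel F
      ((scal (FreeUV K t) F.1 * (freeU K t)ᵀ * scal (FreeUV K t) F⁻¹.1 * freeV K t) i j)
      ((1 : Matrix (Fin t) (Fin t) (FreeUV K t)) i j)

/-- The algebra `H(F)` with generators `u_ij`, `v_ij` and relations
`u ᵗv = ᵗv u = 1 = v F ᵗu F⁻¹ = F ᵗu F⁻¹ v`. -/
def CosovH (F : GL (Fin t) K) : Type u := RingQuot (Rel F)

namespace CosovH

variable (F : GL (Fin t) K)

instance : Ring (CosovH F) := inferInstanceAs (Ring (RingQuot (Rel F)))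

instance : Algebra K (CosovH F) := inferInstanceAs (Algebra K (RingQuot (Rel F)))

/-- The quotient map from the free algebra. -/
def mk : FreeUV K t →ₐ[K] CosovH F := RingQuot.mkAlgHom K (Rel F)

/-- The matrix `u` over `H(F)`. -/
def U : Matrix (Fin t) (Fin t) (CosovH F) := (freeU K t).map (mk F)

/-- The matrix `v` over `H(F)`. -/
def V : Matrix (Fin t) (Fin t) (CosovH F) := (freeV K t).map (mk F)

variable {F} in
theorem map_scal {B C : Type*} [Semiring B] [Algebra K B] [Semiring C] [Algebra K C]
    (f : B →ₐ[K] C) (M : Matrix (Fin t) (Fin t) K) : (scal B M).map f = scal C M := by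
  ext i j; simp

theorem map_relations {F : GL (Fin t) K} {B C : Type*} [Semiring B] [Algebra K B] [Semiring C]
    [Algebra K C] (f : B →ₐ[K] C) {u v : Matrix (Fin t) (Fin t) B} (h : Relations F u v) :
    Relations F (u.map f) (v.map f) := by
  have e : ∀ {M : Matrix (Fin t) (Fin t) B}, M = 1 → M.map f = 1 := by
    rintro _ rfl; exact Matrix.map_one f (map_zero f) (map_one f)
  refine ⟨?_, ?_, ?_, ?_⟩
  · simpa only [Matrix.map_mul, Matrix.transpose_map] using e h.uv
  · simpa only [Matrix.map_mul, Matrix.transpose_map] using e h.vu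
  · simpa only [Matrix.map_mul, Matrix.transpose_map, map_scal] using e h.vFu
  · simpa only [Matrix.map_mul, Matrix.transpose_map, map_scal] using e h.Fuv

theorem relations : Relations F (U F) (V F) := by
  have e : ∀ {M : Matrix (Fin t) (Fin t) (FreeUV K t)},
      (∀ i j, Rel F (M i j) ((1 : Matrix (Fin t) (Fin t) (FreeUV K t)) i j)) →
        M.map (mk F) = 1 := by
    intro M h
    rw [← Matrix.map_one (mk F) (map_zero _) (map_one _)]
    ext i j
    exact RingQuot.mkAlgHom_rel K (h i j)
  refine ⟨?_, ?_, ?_, ?_⟩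
  · simpa only [Matrix.map_mul, Matrix.transpose_map, U, V] using e (Rel.uv (F := F))
  · simpa only [Matrix.map_mul, Matrix.transpose_map, U, V] using e (Rel.vu (F := F))
  · simpa only [Matrix.map_mul, Matrix.transpose_map, map_scal, U, V] using e (Rel.vFu (F := F))
  · simpa only [Matrix.map_mul, Matrix.transpose_map, map_scal, U, V] using e (Rel.Fuv (F := F))

variable {F}

/-- The algebra map from the free algebra given by two matrices. -/
def freeLift {B : Type*} [Semiring B] [Algebra K B] (u v : Matrix (Fin t) (Fin t) B) :
    FreeUV K t →ₐ[K] B :=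
  FreeAlgebra.lift K (Sum.elim (fun p : Fin t × Fin t => u p.1 p.2) fun p => v p.1 p.2)

theorem freeLift_rel {B : Type*} [Semiring B] [Algebra K B] {u v : Matrix (Fin t) (Fin t) B}
    (h : Relations F u v) ⦃x y : FreeUV K t⦄ (hxy : Rel F x y) :
    freeLift u v x = freeLift u v y := by
  have hU : (freeU K t).map (freeLift u v) = u := by ext i j; simp [freeLift, freeU]
  have hV : (freeV K t).map (freeLift u v) = v := by ext i j; simp [freeLift, freeV]
  have e : ∀ {M : Matrix (Fin t) (Fin t) (FreeUV K t)}, M.map (freeLift u v) = 1 →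
      ∀ i j, freeLift u v (M i j) =
        freeLift u v ((1 : Matrix (Fin t) (Fin t) (FreeUV K t)) i j) := by
    intro M hM i j
    rw [← Matrix.map_one (freeLift (K := K) u v) (map_zero _) (map_one _)] at hM
    exact congrFun (congrFun hM i) j
  rcases hxy with ⟨i, j⟩ | ⟨i, j⟩ | ⟨i, j⟩ | ⟨i, j⟩ <;> apply e <;>
    simp only [Matrix.map_mul, Matrix.transpose_map, map_scal, hU, hV]
  exacts [h.uv, h.vu, h.vFu, h.Fuv]

/-- The universal property of `H(F)`. -/
def lift {B : Type*} [Semiring B] [Algebra K B] {u v : Matrix (Fin t) (Fin t) B}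
    (h : Relations F u v) : CosovH F →ₐ[K] B :=
  RingQuot.liftAlgHom K ⟨freeLift u v, freeLift_rel h⟩

theorem lift_U {B : Type*} [Semiring B] [Algebra K B] {u v : Matrix (Fin t) (Fin t) B}
    (h : Relations F u v) (i j) : lift h (U F i j) = u i j := by
  simp only [lift, U, mk, Matrix.map_apply]
  erw [RingQuot.liftAlgHom_mkAlgHom_apply]
  simp [freeLift, freeU]

theorem lift_V {B : Type*} [Semiring B] [Algebra K B] {u v : Matrix (Fin t) (Fin t) B}
    (h : Relations F u v) (i j) : lift h (V F i j) = v i j := by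
  simp only [lift, V, mk, Matrix.map_apply]
  erw [RingQuot.liftAlgHom_mkAlgHom_apply]
  simp [freeLift, freeV]

theorem hom_ext {B : Type*} [Semiring B] [Algebra K B] {f g : CosovH F →ₐ[K] B}
    (hU : ∀ i j, f (U F i j) = g (U F i j)) (hV : ∀ i j, f (V F i j) = g (V F i j)) : f = g := by
  refine RingQuot.ringQuot_ext' K f g (FreeAlgebra.hom_ext (funext ?_))
  rintro (⟨i, j⟩ | ⟨i, j⟩)
  exacts [hU i j, hV i j]

theorem induction {P : CosovH F → Prop} (hK : ∀ r, P (algebraMap K _ r))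
    (hU : ∀ i j, P (U F i j)) (hV : ∀ i j, P (V F i j)) (hadd : ∀ x y, P x → P y → P (x + y))
    (hmul : ∀ x y, P x → P y → P (x * y)) (x) : P x := by
  obtain ⟨x, rfl⟩ := RingQuot.mkAlgHom_surjective K (Rel F) x
  change P (mk F x)
  induction x using FreeAlgebra.induction with
  | grade0 r => rw [AlgHom.commutes]; exact hK r
  | grade1 p =>
    rcases p with ⟨i, j⟩ | ⟨i, j⟩
    exacts [hU i j, hV i j]
  | mul a b ha hb => rw [map_mul]; exact hmul _ _ ha hb
  | add a b ha hb => rw [map_add]; exact hadd _ _ ha hb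

theorem scal_inv {B : Type*} [Semiring B] [Algebra K B] :
    scal B F.1 * scal B F⁻¹.1 = 1 := by
  rw [← Matrix.map_mul, ← Units.val_mul, mul_inv_cancel, Units.val_one]
  exact Matrix.map_one _ (map_zero _) (map_one _)

theorem inv_scal {B : Type*} [Semiring B] [Algebra K B] :
    scal B F⁻¹.1 * scal B F.1 = 1 := by
  rw [← Matrix.map_mul, ← Units.val_mul, inv_mul_cancel, Units.val_one]
  exact Matrix.map_one _ (map_zero _) (map_one _)

theorem transpose_mul_of_commute {B : Type*} [Semiring B] {M N : Matrix (Fin t) (Fin t) B}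
    (h : ∀ i j k l, Commute (M i j) (N k l)) : (M * N)ᵀ = Nᵀ * Mᵀ := by
  ext i j
  simp only [Matrix.transpose_apply, Matrix.mul_apply]
  exact Finset.sum_congr rfl fun k _ => h _ _ _ _

theorem relations_mul {B : Type*} [Semiring B] [Algebra K B]
    {u v u' v' : Matrix (Fin t) (Fin t) B} (h : Relations F u v) (h' : Relations F u' v')
    (hu : ∀ i j k l, Commute (u i j) (u' k l)) (hv : ∀ i j k l, Commute (v i j) (v' k l)) :
    Relations F (u * u') (v * v') := by
  have hi := scal_inv (F := F) (B := B)
  have hi' := inv_scal (F := F) (B := B)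
  set G := scal B F.1
  set G' := scal B F⁻¹.1
  obtain ⟨a1, a2, a3, a4⟩ := h
  obtain ⟨b1, b2, b3, b4⟩ := h'
  have c3 : v' * G * u'ᵀ = G := by
    calc v' * G * u'ᵀ = v' * G * u'ᵀ * (G' * G) := by rw [hi', mul_one]
      _ = G := by rw [← mul_assoc, b3, one_mul]
  have c4 : uᵀ * G' * v = G' := by
    calc uᵀ * G' * v = G' * G * (uᵀ * G' * v) := by rw [hi', one_mul]
      _ = G' * (G * uᵀ * G' * v) := by simp only [mul_assoc]
      _ = G' := by rw [a4, mul_one]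
  refine ⟨?_, ?_, ?_, ?_⟩
  · rw [transpose_mul_of_commute hv]
    calc u * u' * (v'ᵀ * vᵀ) = u * (u' * v'ᵀ) * vᵀ := by simp only [mul_assoc]
      _ = 1 := by rw [b1, mul_one, a1]
  · rw [transpose_mul_of_commute hv]
    calc v'ᵀ * vᵀ * (u * u') = v'ᵀ * (vᵀ * u) * u' := by simp only [mul_assoc]
      _ = 1 := by rw [a2, mul_one, b2]
  · rw [transpose_mul_of_commute hu]
    calc v * v' * G * (u'ᵀ * uᵀ) * G' = v * (v' * G * u'ᵀ) * uᵀ * G' := by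
          simp only [mul_assoc]
      _ = 1 := by rw [c3, a3]
  · rw [transpose_mul_of_commute hu]
    calc G * (u'ᵀ * uᵀ) * G' * (v * v') = G * u'ᵀ * (uᵀ * G' * v) * v' := by
          simp only [mul_assoc]
      _ = 1 := by rw [c4, b4]

variable (F)

/-- The comultiplication `Δ(u_ij) = ∑ₖ u_ik ⊗ u_kj`, `Δ(v_ij) = ∑ₖ v_ik ⊗ v_kj`. -/
def comulHom : CosovH F →ₐ[K] CosovH F ⊗[K] CosovH F :=
  lift (relations_mul (map_relations Algebra.TensorProduct.includeLeft (relations F))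
    (map_relations Algebra.TensorProduct.includeRight (relations F))
    (fun _ _ _ _ => by simp [Commute, SemiconjBy]) (fun _ _ _ _ => by simp [Commute, SemiconjBy]))

theorem comulHom_U (i j) : comulHom F (U F i j) = ∑ k, U F i k ⊗ₜ[K] U F k j := by
  simp [comulHom, lift_U, Matrix.mul_apply]

theorem comulHom_V (i j) : comulHom F (V F i j) = ∑ k, V F i k ⊗ₜ[K] V F k j := by
  simp [comulHom, lift_V, Matrix.mul_apply]

theorem relations_one : Relations F (1 : Matrix (Fin t) (Fin t) K) 1 :=
  ⟨by simp, by simp, by simp, by simp⟩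

/-- The counit `ε(u_ij) = ε(v_ij) = δ_ij`. -/
def counitHom : CosovH F →ₐ[K] K := lift (relations_one F)

theorem counitHom_U (i j) : counitHom F (U F i j) = if i = j then 1 else 0 := by
  rw [counitHom, lift_U, Matrix.one_apply]

theorem counitHom_V (i j) : counitHom F (V F i j) = if i = j then 1 else 0 := by
  rw [counitHom, lift_V, Matrix.one_apply]

instance : Bialgebra K (CosovH F) :=
  Bialgebra.ofAlgHom (comulHom F) (counitHom F)
    (by
      refine hom_ext (fun i j => ?_) (fun i j => ?_)
      · simp only [AlgHom.comp_apply, comulHom_U, map_sum, Algebra.TensorProduct.map_tmul,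
          TensorProduct.sum_tmul, TensorProduct.tmul_sum, AlgHom.id_apply]
        rw [Finset.sum_comm]
        simp
      · simp only [AlgHom.comp_apply, comulHom_V, map_sum, Algebra.TensorProduct.map_tmul,
          TensorProduct.sum_tmul, TensorProduct.tmul_sum, AlgHom.id_apply]
        rw [Finset.sum_comm]
        simp)
    (by
      refine hom_ext (fun i j => ?_) (fun i j => ?_)
      · simp [comulHom_U, counitHom_U, TensorProduct.ite_tmul]
      · simp [comulHom_V, counitHom_V, TensorProduct.ite_tmul])
    (by
      refine hom_ext (fun i j => ?_) (fun i j => ?_)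
      · simp [comulHom_U, counitHom_U, TensorProduct.tmul_ite]
      · simp [comulHom_V, counitHom_V, TensorProduct.tmul_ite])

theorem comul_apply (x : CosovH F) : Coalgebra.comul (R := K) x = comulHom F x := rfl

theorem counit_apply (x : CosovH F) : Coalgebra.counit (R := K) x = counitHom F x := rfl

/-- The matrix `F ᵗu F⁻¹`, which is the image of `v` under the antipode. -/
def W : Matrix (Fin t) (Fin t) (CosovH F) :=
  scal (CosovH F) F.1 * (U F)ᵀ * scal (CosovH F) F⁻¹.1

theorem map_op_mul {B : Type*} [Semiring B] (M N : Matrix (Fin t) (Fin t) B) :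
    M.map MulOpposite.op * N.map MulOpposite.op = (Nᵀ * Mᵀ)ᵀ.map MulOpposite.op := by
  ext i j
  simp [Matrix.mul_apply]

theorem relations_op :
    Relations F ((V F)ᵀ.map MulOpposite.op) ((W F).map MulOpposite.op) := by
  have hs : ∀ M : Matrix (Fin t) (Fin t) K,
      scal (CosovH F)ᵐᵒᵖ M = (scal (CosovH F) M).map MulOpposite.op := fun M => rfl
  have h1 : ((1 : Matrix (Fin t) (Fin t) (CosovH F))ᵀ).map MulOpposite.op = 1 := by
    rw [Matrix.transpose_one]
    exact Matrix.map_one _ rfl rfl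
  have hc : ∀ (M : Matrix (Fin t) (Fin t) K) (N : Matrix (Fin t) (Fin t) (CosovH F)),
      (scal (CosovH F) M * N)ᵀ = Nᵀ * (scal (CosovH F) M)ᵀ := fun M N =>
    transpose_mul_of_commute fun i j _ _ => Algebra.commute_algebraMap_left (M i j) _
  have hc' : ∀ (M : Matrix (Fin t) (Fin t) K) (N : Matrix (Fin t) (Fin t) (CosovH F)),
      (N * scal (CosovH F) M)ᵀ = (scal (CosovH F) M)ᵀ * Nᵀ := fun M N =>
    transpose_mul_of_commute fun _ _ k l => Algebra.commute_algebraMap_right (M k l) _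
  obtain ⟨a1, a2, a3, a4⟩ := relations F
  have hi : (scal (CosovH F) F.1)ᵀ * (scal (CosovH F) F⁻¹.1)ᵀ = 1 := by
    rw [← hc, inv_scal, Matrix.transpose_one]
  have hi' : (scal (CosovH F) F⁻¹.1)ᵀ * (scal (CosovH F) F.1)ᵀ = 1 := by
    rw [← hc, scal_inv, Matrix.transpose_one]
  have hW : (W F)ᵀ = (scal (CosovH F) F⁻¹.1)ᵀ * (U F * (scal (CosovH F) F.1)ᵀ) := by
    rw [W, hc', hc, Matrix.transpose_transpose]
  refine ⟨?_, ?_, ?_, ?_⟩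
  · rw [← Matrix.transpose_map, map_op_mul, Matrix.transpose_transpose,
      Matrix.transpose_transpose, W, a4, ← h1, Matrix.transpose_one]
  · rw [← Matrix.transpose_map, map_op_mul, Matrix.transpose_transpose,
      Matrix.transpose_transpose, W, ← mul_assoc, ← mul_assoc, a3, ← h1, Matrix.transpose_one]
  · rw [hs, hs, ← Matrix.transpose_map, Matrix.transpose_transpose]
    simp only [map_op_mul, Matrix.transpose_transpose]
    rw [← h1]
    congr 2
    rw [hW]
    calc (scal (CosovH F) F⁻¹.1)ᵀ * ((V F)ᵀ * ((scal (CosovH F) F.1)ᵀ *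
          ((scal (CosovH F) F⁻¹.1)ᵀ * (U F * (scal (CosovH F) F.1)ᵀ))))
        = (scal (CosovH F) F⁻¹.1)ᵀ * ((V F)ᵀ * (((scal (CosovH F) F.1)ᵀ *
          (scal (CosovH F) F⁻¹.1)ᵀ) * U F)) * (scal (CosovH F) F.1)ᵀ := by
          simp only [mul_assoc]
      _ = 1 := by rw [hi, one_mul, a2, mul_one, hi']
  · rw [hs, hs, ← Matrix.transpose_map, Matrix.transpose_transpose]
    simp only [map_op_mul, Matrix.transpose_transpose]
    rw [← h1]
    congr 2
    rw [hW]
    calc (scal (CosovH F) F⁻¹.1)ᵀ * (U F * (scal (CosovH F) F.1)ᵀ) *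
          ((scal (CosovH F) F⁻¹.1)ᵀ * ((V F)ᵀ * (scal (CosovH F) F.1)ᵀ))
        = (scal (CosovH F) F⁻¹.1)ᵀ * (U F * ((scal (CosovH F) F.1)ᵀ *
          (scal (CosovH F) F⁻¹.1)ᵀ) * (V F)ᵀ) * (scal (CosovH F) F.1)ᵀ := by
          simp only [mul_assoc]
      _ = 1 := by rw [hi, mul_one, a1, mul_one, hi']

/-- The antipode as an algebra morphism to the opposite algebra. -/
def antipodeOp : CosovH F →ₐ[K] (CosovH F)ᵐᵒᵖ := lift (relations_op F)

/-- The antipode: the anti-homomorphism with `S(u) = ᵗv`, `S(v) = F ᵗu F⁻¹`. -/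
def antipodeLin : CosovH F →ₗ[K] CosovH F :=
  (MulOpposite.opLinearEquiv K).symm.toLinearMap ∘ₗ (antipodeOp F).toLinearMap

theorem antipodeLin_U (i j) : antipodeLin F (U F i j) = V F j i := by
  simp [antipodeLin, antipodeOp, lift_U]

theorem antipodeLin_V (i j) : antipodeLin F (V F i j) = W F i j := by
  simp [antipodeLin, antipodeOp, lift_V]

theorem antipodeLin_mul (x y : CosovH F) :
    antipodeLin F (x * y) = antipodeLin F y * antipodeLin F x := by
  simp [antipodeLin]

theorem antipodeLin_algebraMap (r : K) :
    antipodeLin F (algebraMap K _ r) = algebraMap K _ r := by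
  simp [antipodeLin]

theorem antipode_left (x : CosovH F) :
    LinearMap.mul' K _ ((antipodeLin F).rTensor _ (comulHom F x)) =
      algebraMap K _ (counitHom F x) := by
  have key : ∀ (p q : CosovH F ⊗[K] CosovH F) (r : K),
      LinearMap.mul' K _ ((antipodeLin F).rTensor _ p) = algebraMap K _ r →
      LinearMap.mul' K _ ((antipodeLin F).rTensor _ (p * q)) =
        algebraMap K _ r * LinearMap.mul' K _ ((antipodeLin F).rTensor _ q) := by
    intro p q r hp
    induction q with
    | zero => simp
    | add q₁ q₂ h₁ h₂ => simp only [mul_add, map_add, h₁, h₂]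
    | tmul c d =>
      have : LinearMap.mul' K _ ((antipodeLin F).rTensor _ (p * c ⊗ₜ[K] d)) =
          antipodeLin F c * LinearMap.mul' K _ ((antipodeLin F).rTensor _ p) * d := by
        clear hp
        induction p with
        | zero => simp
        | add p₁ p₂ h₁ h₂ => simp only [add_mul, mul_add, map_add, h₁, h₂]
        | tmul a b => simp [antipodeLin_mul, mul_assoc]
      rw [this, hp, ← Algebra.commutes]
      simp [mul_assoc]
  obtain ⟨a1, a2, a3, a4⟩ := relations F
  induction x using induction with
  | hK r =>
    rw [AlgHom.commutes, AlgHom.commutes, Algebra.TensorProduct.algebraMap_apply]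
    simp [antipodeLin_algebraMap]
  | hadd x y hx hy => simp only [map_add, hx, hy]
  | hmul x y hx hy => rw [map_mul, key _ _ _ hx, hy, map_mul, map_mul]
  | hU i j =>
    have := congrFun (congrFun a2 i) j
    simp only [Matrix.mul_apply, Matrix.transpose_apply, Matrix.one_apply] at this
    simp only [comulHom_U, map_sum, LinearMap.rTensor_tmul, LinearMap.mul'_apply, antipodeLin_U,
      this, counitHom_U]
    split_ifs <;> simp
  | hV i j =>
    have : (W F * V F) i j = _ := congrFun (congrFun a4 i) j
    simp only [Matrix.mul_apply, Matrix.one_apply] at this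
    simp only [comulHom_V, map_sum, LinearMap.rTensor_tmul, LinearMap.mul'_apply, antipodeLin_V,
      this, counitHom_V]
    split_ifs <;> simp

theorem antipode_right (x : CosovH F) :
    LinearMap.mul' K _ ((antipodeLin F).lTensor _ (comulHom F x)) =
      algebraMap K _ (counitHom F x) := by
  have key : ∀ (p q : CosovH F ⊗[K] CosovH F) (r : K),
      LinearMap.mul' K _ ((antipodeLin F).lTensor _ q) = algebraMap K _ r →
      LinearMap.mul' K _ ((antipodeLin F).lTensor _ (p * q)) =
        LinearMap.mul' K _ ((antipodeLin F).lTensor _ p) * algebraMap K _ r := by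
    intro p q r hq
    induction p with
    | zero => simp
    | add p₁ p₂ h₁ h₂ => simp only [add_mul, map_add, h₁, h₂]
    | tmul a b =>
      have : LinearMap.mul' K _ ((antipodeLin F).lTensor _ (a ⊗ₜ[K] b * q)) =
          a * LinearMap.mul' K _ ((antipodeLin F).lTensor _ q) * antipodeLin F b := by
        clear hq
        induction q with
        | zero => simp
        | add q₁ q₂ h₁ h₂ => simp only [add_mul, mul_add, map_add, h₁, h₂]
        | tmul c d => simp [antipodeLin_mul, mul_assoc]
      rw [this, hq, mul_assoc, Algebra.commutes]
      simp [mul_assoc]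
  obtain ⟨a1, a2, a3, a4⟩ := relations F
  induction x using induction with
  | hK r =>
    rw [AlgHom.commutes, AlgHom.commutes, Algebra.TensorProduct.algebraMap_apply]
    have := antipodeLin_algebraMap F 1
    rw [map_one] at this
    simp [this]
  | hadd x y hx hy => simp only [map_add, hx, hy]
  | hmul x y hx hy => rw [map_mul, key _ _ _ hy, hx, map_mul, map_mul]
  | hU i j =>
    have := congrFun (congrFun a1 i) j
    simp only [Matrix.mul_apply, Matrix.transpose_apply, Matrix.one_apply] at this
    simp only [comulHom_U, map_sum, LinearMap.lTensor_tmul, LinearMap.mul'_apply, antipodeLin_U,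
      this, counitHom_U]
    split_ifs <;> simp
  | hV i j =>
    have : (V F * W F) i j = _ := congrFun (congrFun (by
      simpa only [W, mul_assoc] using a3 : V F * W F = 1) i) j
    simp only [Matrix.mul_apply, Matrix.one_apply] at this
    simp only [comulHom_V, map_sum, LinearMap.lTensor_tmul, LinearMap.mul'_apply, antipodeLin_V,
      this, counitHom_V]
    split_ifs <;> simp

/-- The Hopf algebra `H(F)`, the universal cosovereign Hopf algebra. -/
instance : HopfAlgebra K (CosovH F) where
  antipode := antipodeLin F
  mul_antipode_rTensor_comul := LinearMap.ext fun x => antipode_left F x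
  mul_antipode_lTensor_comul := LinearMap.ext fun x => antipode_right F x

/-- The matrix `u` over `H(F)` is multiplicative. -/
theorem isMultiplicative_U : IsMultiplicative (K := K) (U F) :=
  ⟨comulHom_U F, counitHom_U F⟩

end CosovH

end Cosovereign

end FreeFFT

end

/-! Write `H` for `H(F)`. Applying the antipode identity turns the condition `S(a₍₁₎) b₍₋₁₎ ⊗ a₍₀₎ ⊗
b₍₀₎ = 1 ⊗ a ⊗ b` into the cotensor condition `(ρ ⊗ id) x = (id ⊗ λ) x`
(`rTensor_eq_of_mem_coinvariantAlgebra`). Both coactions factor through the subalgebra of `H`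
generated by the `u_ij`. The key point is that this subalgebra is free (`freeToH_injective`). By
flatness over a field, the cotensor condition may then be tested in `A(m,t) ⊗ A(t,t) ⊗ A(t,n)`,
where the two coactions are themselves instances of `theta`.

There the problem is combinatorial. The coefficient of `theta f` at a pair of words `(a, b)` is zero
unless the inner indices of `a` and `b` agree, and is then the coefficient of `f` at the word of
outer indices (`repr_theta`). This gives injectivity. Comparing coefficients in the cotensor
condition shows that the coefficients of `x` have the same shape: they are supported on matching
inner indices and do not depend on them. Hence `x` lies in the image (`mem_range_theta`).

Freeness of the `u_ij` is proved by representations of `H` on functions on `ℤ × ℤ`. For each word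
there is one in which a single matrix coefficient reads off the coefficient of that word. -/

open scoped TensorProduct

noncomputable section

namespace FreeFFT

universe u

/-! ### Word bases of free algebras and of their tensor products. -/

section Words

variable (K : Type*) [Field K] (X : Type*)

/-- The basis of words of the free algebra. -/
def wordBasis : Module.Basis (List X) K (FreeAlgebra K X) :=
  (FreeAlgebra.basisFreeMonoid K X).reindex FreeMonoid.toList

variable {X}

theorem wordBasis_apply (w : List X) :
    wordBasis K X w = (w.map (FreeAlgebra.ι K)).prod := by
  rw [wordBasis, Module.Basis.reindex_apply, FreeAlgebra.basisFreeMonoid]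
  simp [FreeAlgebra.equivMonoidAlgebraFreeMonoid, FreeMonoid.lift_apply]

theorem wordBasis_nil : wordBasis K X [] = 1 := by simp [wordBasis_apply]

theorem wordBasis_cons (x : X) (w : List X) :
    wordBasis K X (x :: w) = FreeAlgebra.ι K x * wordBasis K X w := by simp [wordBasis_apply]

variable {K} in
/-- Induction over the elements of a module along a basis. -/
theorem basis_induction {ι M : Type*} [AddCommGroup M] [Module K M] (b : Module.Basis ι K M)
    {P : M → Prop} (zero : P 0) (coe : ∀ i, P (b i)) (add : ∀ f g, P f → P g → P (f + g))
    (smul : ∀ (c : K) f, P f → P (c • f)) (f : M) : P f :=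
  Submodule.span_induction (p := fun x _ => P x) (by rintro _ ⟨i, rfl⟩; exact coe i) zero
    (fun f g _ _ => add f g) (fun c f _ => smul c f) (b.mem_span f)

variable (X) in
/-- The basis of pairs of words of a tensor product of two free algebras. -/
def pairBasis (Y : Type*) :
    Module.Basis (List X × List Y) K (FreeAlgebra K X ⊗[K] FreeAlgebra K Y) :=
  (wordBasis K X).tensorProduct (wordBasis K Y)

theorem pairBasis_repr_tmul {Y : Type*} (f : FreeAlgebra K X) (g : FreeAlgebra K Y)
    (a : List X) (b : List Y) :
    (pairBasis K X Y).repr (f ⊗ₜ g) (a, b) =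
      (wordBasis K X).repr f a * (wordBasis K Y).repr g b := by
  simp [pairBasis, mul_comm]

theorem wordBasis_repr_ι_mul [DecidableEq X] (x : X) (f : FreeAlgebra K X) (x' : X) (a : List X) :
    (wordBasis K X).repr (FreeAlgebra.ι K x * f) (x' :: a) =
      if x' = x then (wordBasis K X).repr f a else 0 := by
  induction f using basis_induction (wordBasis K X) with
  | zero => simp
  | coe w =>
    rw [← wordBasis_cons]
    simp only [Module.Basis.repr_self, Finsupp.single_apply, List.cons.injEq]
    split_ifs <;> simp_all
  | add f g hf hg =>
    rw [mul_add, map_add, map_add]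
    simp only [Finsupp.add_apply, hf, hg]
    split_ifs <;> simp
  | smul c f hf => simp only [mul_smul_comm, map_smul, Finsupp.smul_apply, hf]; split_ifs <;> simp

theorem wordBasis_repr_ι_mul_nil (x : X) (f : FreeAlgebra K X) :
    (wordBasis K X).repr (FreeAlgebra.ι K x * f) [] = 0 := by
  classical
  induction f using basis_induction (wordBasis K X) with
  | zero => simp
  | coe w =>
    rw [← wordBasis_cons]
    simp
  | add f g hf hg => rw [mul_add, map_add]; simp only [Finsupp.add_apply, hf, hg]; simp
  | smul c f hf => simp only [mul_smul_comm, map_smul, Finsupp.smul_apply, hf]; simp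

end Words

/-! ### The entries `u_ij` generate a free subalgebra of `H(F)`. -/

section Rep

open Matrix CosovH

variable {K : Type u} [Field K] {t : ℕ} (F : GL (Fin t) K) (X Y : ℤ → Matrix (Fin t) (Fin t) K)

/-- Operators on functions on `ℤ × ℤ` representing the generators `u_ij` of `H(F)`. The first
index is shifted, and the block `!![ᵗF, X s; 0, 1]` acts on the second indices `s`, `s + 1`. -/
def repU : Matrix (Fin t) (Fin t) (Module.End K (ℤ → ℤ → K)) := Matrix.of fun i j =>
  { toFun f s k :=
      if k = s then F.1 j i * f (s + 1) k + X s i j * f (s + 1) (k + 1)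
      else if i = j then f (s + 1) k else 0
    map_add' f g := by
      ext s k
      simp only [Pi.add_apply]
      split_ifs <;> ring
    map_smul' c f := by
      ext s k
      simp only [Pi.smul_apply, smul_eq_mul, RingHom.id_apply]
      split_ifs <;> ring }

/-- Operators on functions on `ℤ × ℤ` representing the generators `v_ij` of `H(F)`. -/
def repV : Matrix (Fin t) (Fin t) (Module.End K (ℤ → ℤ → K)) := Matrix.of fun i j =>
  { toFun f s k :=
      if k = s - 1 then F⁻¹.1 i j * f (s - 1) k - Y (s - 1) i j * f (s - 1) (k + 1)
      else if i = j then f (s - 1) k else 0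
    map_add' f g := by
      ext s k
      simp only [Pi.add_apply]
      split_ifs <;> ring
    map_smul' c f := by
      ext s k
      simp only [Pi.smul_apply, smul_eq_mul, RingHom.id_apply]
      split_ifs <;> ring }

theorem repU_apply (i j) (f : ℤ → ℤ → K) (s k : ℤ) : repU F X i j f s k =
    if k = s then F.1 j i * f (s + 1) k + X s i j * f (s + 1) (k + 1)
      else if i = j then f (s + 1) k else 0 := rfl

theorem repV_apply (i j) (f : ℤ → ℤ → K) (s k : ℤ) : repV F Y i j f s k =
    if k = s - 1 then F⁻¹.1 i j * f (s - 1) k - Y (s - 1) i j * f (s - 1) (k + 1)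
      else if i = j then f (s - 1) k else 0 := rfl

/-- At each `s`, `u` is the block matrix `!![ᵗF, X s; 0, 1]`, and `ᵗv` is its inverse, which forces
`Y s = ᵗ(X s) F⁻¹`. The corner `ᵗF` is chosen so that the relations involving `F` hold with the same
`Y` and with no constraint on `X`. The shift in `s` lets successive letters of a product meet
independent matrices `X s`. -/
theorem rep_relations (hY : ∀ s, Y s * F.1 = (X s)ᵀ) : Relations F (repU F X) (repV F Y) := by
  have hi : F.1 * F⁻¹.1 = 1 := by rw [← Units.val_mul, mul_inv_cancel, Units.val_one]
  have hi' : F⁻¹.1 * F.1 = 1 := by rw [← Units.val_mul, inv_mul_cancel, Units.val_one]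
  have hX : ∀ s, (X s)ᵀ * F⁻¹.1 = Y s := fun s => by rw [← hY, mul_assoc, hi, mul_one]
  have h1 : ∀ (i j : Fin t) (f : ℤ → ℤ → K) (s k : ℤ),
      (1 : Matrix (Fin t) (Fin t) (Module.End K (ℤ → ℤ → K))) i j f s k =
        (1 : Matrix (Fin t) (Fin t) K) i j * f s k := by
    intro i j f s k
    simp only [Matrix.one_apply]
    split_ifs <;> simp
  have h2 : ∀ i j : Fin t, (1 : Matrix (Fin t) (Fin t) K) j i = (1 : Matrix _ _ K) i j :=
    fun i j => by simp [Matrix.one_apply, eq_comm]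
  -- The diagonal corner is `F⁻¹ F F = F`; the off-diagonal block is `F⁻¹ F ᵗX - Y F`, which
  -- vanishes by `hY`.
  have h3 : repV F Y * scal _ F.1 * (repU F X)ᵀ = scal _ F.1 := by
    ext i j f s k
    simp only [Matrix.mul_apply, Matrix.transpose_apply, Matrix.map_apply, LinearMap.sum_apply,
      Finset.sum_apply, Finset.sum_mul, Module.End.mul_apply, Module.algebraMap_end_apply,
      Pi.smul_apply, smul_eq_mul, repV_apply, repU_apply, sub_add_cancel]
    rw [Finset.sum_comm]
    -- Off this row both operators are merely a shift times `δ_ij`.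
    by_cases hk : k = s - 1
    · subst hk
      have n : ¬ (s = s - 1) := by omega
      trans (F⁻¹.1 * (F.1 * F.1)) i j * f s (s - 1) + (F⁻¹.1 * (F.1 * (X (s - 1))ᵀ)) i j * f s s -
        (Y (s - 1) * F.1) i j * f s s
      · simp [n, Matrix.mul_apply, Finset.sum_add_distrib, mul_add, Finset.sum_mul, mul_assoc,
          Finset.mul_sum]
      · rw [← mul_assoc, ← mul_assoc, hi', one_mul, one_mul, hY]
        ring
    · simp [hk]
  have h4 : (repU F X)ᵀ * scal _ F⁻¹.1 * repV F Y = scal _ F⁻¹.1 := by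
    ext i j f s k
    simp only [Matrix.mul_apply, Matrix.transpose_apply, Matrix.map_apply, LinearMap.sum_apply,
      Finset.sum_apply, Finset.sum_mul, Module.End.mul_apply, Module.algebraMap_end_apply,
      Pi.smul_apply, smul_eq_mul, repV_apply, repU_apply, add_sub_cancel_right]
    rw [Finset.sum_comm]
    by_cases hk : k = s
    · subst hk
      have n : ¬ (k + 1 = k) := by omega
      trans (F.1 * (F⁻¹.1 * F⁻¹.1)) i j * f k k - (F.1 * (F⁻¹.1 * Y k)) i j * f k (k + 1) +
        ((X k)ᵀ * F⁻¹.1) i j * f k (k + 1)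
      · simp [n, Matrix.mul_apply, Finset.sum_add_distrib, mul_sub, Finset.sum_mul, mul_assoc,
          Finset.mul_sum]
      · rw [← mul_assoc, ← mul_assoc, hi, one_mul, one_mul, hX]
        ring
    · simp [hk]
  refine ⟨?_, ?_, ?_, ?_⟩
  · ext i j f s k
    rw [h1]
    simp only [Matrix.mul_apply, Matrix.transpose_apply, LinearMap.sum_apply,
      Finset.sum_apply, Module.End.mul_apply, repV_apply, repU_apply, add_sub_cancel_right]
    by_cases hk : k = s
    · subst hk
      have n : ¬ (k + 1 = k) := by omega
      trans (F⁻¹.1 * F.1) j i * f k k - (Y k * F.1) j i * f k (k + 1) + X k i j * f k (k + 1)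
      · simp [n, Matrix.mul_apply, Finset.sum_add_distrib, mul_sub, Finset.sum_mul, mul_left_comm,
          mul_assoc]
      · rw [hi', hY, Matrix.transpose_apply, h2]
        ring
    · simp [hk, Matrix.one_apply, eq_comm]
  · ext i j f s k
    rw [h1]
    simp only [Matrix.mul_apply, Matrix.transpose_apply, LinearMap.sum_apply,
      Finset.sum_apply, Module.End.mul_apply, repV_apply, repU_apply, sub_add_cancel]
    by_cases hk : k = s - 1
    · subst hk
      have n : ¬ (s = s - 1) := by omega
      trans (F.1 * F⁻¹.1) j i * f s (s - 1) + ((X (s - 1))ᵀ * F⁻¹.1) j i * f s s -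
        Y (s - 1) j i * f s s
      · simp [n, Matrix.mul_apply, Finset.sum_add_distrib, mul_add, Finset.sum_mul, mul_left_comm,
          mul_assoc]
      · rw [hi, hX, h2]
        ring
    · simp [hk, Matrix.one_apply, eq_comm]
  · rw [h3, scal_inv]
  · rw [mul_assoc, mul_assoc, ← mul_assoc _ _ (repV F Y), h4, scal_inv]

/-- The morphism from the free algebra on the `u_ij` to `H(F)`. -/
def freeToH : FreeMat K t t →ₐ[K] CosovH F := FreeAlgebra.lift K fun p => U F p.1 p.2

/-- The matrices `X s` for which `repU` detects the word `w`: the elementary matrix at the letter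
of `w` at position `s`. -/
def wordX (w : List (Fin t × Fin t)) (s : ℤ) : Matrix (Fin t) (Fin t) K :=
  Matrix.of fun i j => if 0 ≤ s ∧ w[s.toNat]? = some (i, j) then 1 else 0

/-- The representation of the free algebra on the `u_ij` which detects the word `w`. -/
def wordRep (w : List (Fin t × Fin t)) : FreeMat K t t →ₐ[K] Module.End K (ℤ → ℤ → K) :=
  FreeAlgebra.lift K fun p => repU F (wordX w) p.1 p.2

theorem wordRep_eq (w : List (Fin t × Fin t)) :
    ∃ φ : CosovH F →ₐ[K] Module.End K (ℤ → ℤ → K), wordRep F w = φ.comp (freeToH F) := by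
  refine ⟨lift (rep_relations F (wordX w) (fun s => (wordX w s)ᵀ * F⁻¹.1) fun s => ?_), ?_⟩
  · rw [mul_assoc, ← Units.val_mul, inv_mul_cancel, Units.val_one, mul_one]
  · refine FreeAlgebra.hom_ext (funext fun p => ?_)
    simp [wordRep, freeToH, lift_U]

/-- The second index can grow only on the diagonal `k = s`, while the first grows with every letter.
Once `k < s`, the diagonal, where the test function is supported, is never reached again. -/
theorem wordRep_apply_of_lt (w w' : List (Fin t × Fin t)) (s k : ℤ) (h : k < s) :
    wordRep F w (wordBasis K _ w') (fun a b => if a = w.length ∧ b = w.length then 1 else 0) s k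
      = 0 := by
  induction w' generalizing s with
  | nil =>
    simp only [wordBasis_nil, map_one, Module.End.one_apply]
    rw [if_neg]; omega
  | cons x w' ih =>
    rw [wordBasis_cons, map_mul, Module.End.mul_apply]
    simp only [wordRep, FreeAlgebra.lift_ι_apply, repU_apply]
    rw [if_neg h.ne]
    split_ifs
    · exact ih _ (by omega)
    · rfl

/-- Only the path along the diagonal from `(s, s)` to the end point contributes. It picks up the
factor `X s i j` at each letter, which compares that letter with the one of `w` at position `s`. -/
theorem wordRep_apply (w w' : List (Fin t × Fin t)) (s : ℕ) (hs : s ≤ w.length) :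
    wordRep F w (wordBasis K _ w') (fun a b => if a = w.length ∧ b = w.length then 1 else 0) s s
      = if w' = w.drop s then 1 else 0 := by
  induction w' generalizing s with
  | nil =>
    simp only [wordBasis_nil, map_one, Module.End.one_apply]
    refine if_congr ?_ rfl rfl
    rw [eq_comm (a := []), List.drop_eq_nil_iff]
    omega
  | cons x w' ih =>
    rw [wordBasis_cons, map_mul, Module.End.mul_apply]
    -- The `ᵗF` term leaves the diagonal, so it contributes nothing.
    have h0 := wordRep_apply_of_lt F w w' (s + 1) s (by omega)
    have e : wordRep F w (FreeAlgebra.ι K x) = repU F (wordX w) x.1 x.2 := by simp [wordRep]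
    rw [e, repU_apply, if_pos rfl, h0, mul_zero, zero_add]
    simp only [wordX, Matrix.of_apply, Int.toNat_natCast, Int.natCast_nonneg, true_and]
    rcases hs.lt_or_eq with h | h
    · have := ih (s + 1) (by omega)
      push_cast at this
      rw [this, List.drop_eq_getElem_cons h, List.getElem?_eq_getElem h]
      simp only [Option.some.injEq, List.cons.injEq, Prod.mk.eta, ite_and, mul_ite, mul_one,
        mul_zero, eq_comm (a := x)]
      split_ifs <;> rfl
    -- At `s = w.length` the lookup in `w` fails, so the matrix is zero, in accordance with `w.drop
    -- s = []`.
    · subst h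
      simp

theorem freeToH_injective : Function.Injective (freeToH F) := by
  rw [injective_iff_map_eq_zero]
  intro f hf
  refine (wordBasis K _).repr.map_eq_zero_iff.1 (Finsupp.ext fun w => ?_)
  have key : ∀ g : FreeMat K t t, wordRep F w g
      (fun a b => if a = w.length ∧ b = w.length then 1 else 0) 0 0 = (wordBasis K _).repr g w := by
    intro g
    induction g using basis_induction (wordBasis K _) with
    | zero => simp
    | coe w' =>
      have := wordRep_apply F w w' 0 (by simp)
      rw [Nat.cast_zero] at this
      rw [this, Module.Basis.repr_self, Finsupp.single_apply, List.drop_zero]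
    | add f g hf hg =>
      rw [map_add, LinearMap.add_apply, Pi.add_apply, Pi.add_apply, hf, hg, map_add,
        Finsupp.add_apply]
    | smul c f hf =>
      rw [map_smul, LinearMap.smul_apply, Pi.smul_apply, Pi.smul_apply, hf, map_smul,
        Finsupp.smul_apply]
  obtain ⟨φ, hφ⟩ := wordRep_eq F w
  rw [← key, hφ, AlgHom.comp_apply, hf]
  simp

end Rep

/-! ### Coefficients of `theta` and the cotensor condition over `A(t,t)`. -/

section Coefficients

variable (K : Type*) [Field K]

theorem pairBasis_repr_ι_mul {X Y : Type*} [DecidableEq X] [DecidableEq Y] (x x' : X) (y y' : Y)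
    (T : FreeAlgebra K X ⊗[K] FreeAlgebra K Y) (a : List X) (b : List Y) :
    (pairBasis K X Y).repr ((FreeAlgebra.ι K x ⊗ₜ FreeAlgebra.ι K y) * T) (x' :: a, y' :: b) =
      if x' = x ∧ y' = y then (pairBasis K X Y).repr T (a, b) else 0 := by
  induction T with
  | zero => simp
  | add p q hp hq => rw [mul_add, map_add, map_add, Finsupp.add_apply, hp, hq]; split_ifs <;> simp
  | tmul f g =>
    rw [Algebra.TensorProduct.tmul_mul_tmul, pairBasis_repr_tmul, pairBasis_repr_tmul,
      wordBasis_repr_ι_mul, wordBasis_repr_ι_mul]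
    split_ifs <;> simp_all

theorem pairBasis_repr_ι_mul_nil_left {X Y : Type*} (x : X) (y : Y)
    (T : FreeAlgebra K X ⊗[K] FreeAlgebra K Y) (b : List Y) :
    (pairBasis K X Y).repr ((FreeAlgebra.ι K x ⊗ₜ FreeAlgebra.ι K y) * T) ([], b) = 0 := by
  induction T with
  | zero => simp
  | add p q hp hq => rw [mul_add, map_add, Finsupp.add_apply, hp, hq, add_zero]
  | tmul f g =>
    rw [Algebra.TensorProduct.tmul_mul_tmul, pairBasis_repr_tmul, wordBasis_repr_ι_mul_nil,
      zero_mul]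

theorem pairBasis_repr_ι_mul_nil_right {X Y : Type*} (x : X) (y : Y)
    (T : FreeAlgebra K X ⊗[K] FreeAlgebra K Y) (a : List X) :
    (pairBasis K X Y).repr ((FreeAlgebra.ι K x ⊗ₜ FreeAlgebra.ι K y) * T) (a, []) = 0 := by
  induction T with
  | zero => simp
  | add p q hp hq => rw [mul_add, map_add, Finsupp.add_apply, hp, hq, add_zero]
  | tmul f g =>
    rw [Algebra.TensorProduct.tmul_mul_tmul, pairBasis_repr_tmul, wordBasis_repr_ι_mul_nil,
      mul_zero]

/-- The coefficients of `theta f` in the basis of pairs of words. -/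
theorem repr_theta {m n t : ℕ} (f : FreeMat K m n) (a : List (Fin m × Fin t))
    (b : List (Fin t × Fin n)) :
    (pairBasis K _ _).repr (theta K m n t f) (a, b) =
      if a.map Prod.snd = b.map Prod.fst then
        (wordBasis K _).repr f ((a.map Prod.fst).zip (b.map Prod.snd)) else 0 := by
  induction f using basis_induction (wordBasis K _) with
  | zero => simp
  | add f g hf hg =>
    rw [map_add, map_add, map_add, Finsupp.add_apply, Finsupp.add_apply, hf, hg]
    split_ifs <;> simp
  | smul c f hf =>
    rw [map_smul, map_smul, map_smul, Finsupp.smul_apply, Finsupp.smul_apply, hf]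
    split_ifs <;> simp
  | coe w =>
    induction w generalizing a b with
    | nil =>
      rw [wordBasis_nil, map_one, Algebra.TensorProduct.one_def, pairBasis_repr_tmul,
        ← wordBasis_nil, ← wordBasis_nil, ← wordBasis_nil]
      simp only [Module.Basis.repr_self, Finsupp.single_apply]
      cases a <;> cases b <;> simp
    | cons x w ih =>
      obtain ⟨i, j⟩ := x
      rw [wordBasis_cons, map_mul]
      have e : theta K m n t (FreeAlgebra.ι K (i, j)) =
          ∑ k : Fin t, FreeAlgebra.ι K (i, k) ⊗ₜ[K] FreeAlgebra.ι K (k, j) := by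
        simp [theta, gen]
      rw [e, Finset.sum_mul, map_sum, Finsupp.finsetSum_apply]
      match a, b with
      | [], [] => simp [pairBasis_repr_ι_mul_nil_left, wordBasis_repr_ι_mul_nil]
      | [], _ :: _ => simp [pairBasis_repr_ι_mul_nil_left]
      | _ :: _, [] => simp [pairBasis_repr_ι_mul_nil_right]
      | (i', k') :: a, (k'', j') :: b =>
        simp only [pairBasis_repr_ι_mul, ih, List.map_cons, List.zip_cons_cons,
          wordBasis_repr_ι_mul, Prod.mk.injEq, List.cons.injEq]
        -- The sum over `k` has at most one nonzero term, the one with `k = k' = k''`.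
        by_cases h : k' = k'' ∧ i' = i ∧ j' = j
        · obtain ⟨rfl, rfl, rfl⟩ := h
          simp
        · rw [Finset.sum_eq_zero fun k _ => if_neg ?_]
          · split_ifs <;> simp_all
          · rintro ⟨⟨rfl, rfl⟩, rfl, rfl⟩
            exact h ⟨rfl, rfl, rfl⟩

/-- The coefficient of `f` at `w` reappears in `theta f` at the pair of words whose inner indices
are all `0`; this index exists because `0 < t`. -/
theorem theta_injective {m n t : ℕ} (ht : 0 < t) : Function.Injective (theta K m n t) := by
  rw [injective_iff_map_eq_zero]
  intro f hf
  refine (wordBasis K _).repr.map_eq_zero_iff.1 (Finsupp.ext fun w => ?_)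
  have := repr_theta K (t := t) f (w.map fun p => (p.1, ⟨0, ht⟩)) (w.map fun p => (⟨0, ht⟩, p.2))
  rw [hf] at this
  simpa [Function.comp_def, List.zip_map'] using this.symm

/-- An element of `A(m,t) ⊗ A(t,n)` on which the two coactions of the free bialgebra `A(t,t)` agree
is in the image of `theta`. -/
theorem mem_range_theta {m n t : ℕ} (ht : 0 < t) (x : FreeMat K m t ⊗[K] FreeMat K t n)
    (hx : (theta K m t t).toLinearMap.rTensor (FreeMat K t n) x =
      (TensorProduct.assoc K _ _ _).symm ((theta K t n t).toLinearMap.lTensor (FreeMat K m t) x)) :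
    x ∈ Set.range (theta K m n t) := by
  set c := (pairBasis K (Fin m × Fin t) (Fin t × Fin n)).repr x with hc
  let B := (pairBasis K (Fin m × Fin t) (Fin t × Fin t)).tensorProduct
    (wordBasis K (Fin t × Fin n))
  have hl : ∀ (a : List (Fin m × Fin t)) (w : List (Fin t × Fin t)) (b : List (Fin t × Fin n)),
      B.repr ((theta K m t t).toLinearMap.rTensor (FreeMat K t n) x) ((a, w), b) =
        if a.map Prod.snd = w.map Prod.fst then c ((a.map Prod.fst).zip (w.map Prod.snd), b)
          else 0 := by
    intro a w b
    rw [hc]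
    clear hx
    induction x with
    | zero => simp
    | add p q hp hq =>
      rw [map_add, map_add, map_add, Finsupp.add_apply, Finsupp.add_apply, hp rfl, hq rfl]
      split_ifs <;> simp
    | tmul f g =>
      simp only [B, LinearMap.rTensor_tmul, Module.Basis.tensorProduct_repr_tmul_apply,
        AlgHom.toLinearMap_apply, repr_theta, pairBasis_repr_tmul]
      split_ifs <;> simp [mul_comm]
  have hr : ∀ (a : List (Fin m × Fin t)) (w : List (Fin t × Fin t)) (b : List (Fin t × Fin n)),
      B.repr ((TensorProduct.assoc K _ _ _).symm
        ((theta K t n t).toLinearMap.lTensor (FreeMat K m t) x)) ((a, w), b) =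
        if w.map Prod.snd = b.map Prod.fst then c (a, (w.map Prod.fst).zip (b.map Prod.snd))
          else 0 := by
    intro a w b
    rw [hc]
    clear hx hl
    induction x with
    | zero => simp
    | add p q hp hq =>
      simp only [map_add, Finsupp.add_apply, hp rfl, hq rfl]
      split_ifs <;> simp
    | tmul f g =>
      rw [LinearMap.lTensor_tmul, AlgHom.toLinearMap_apply, pairBasis_repr_tmul]
      have e : ∀ T, B.repr ((TensorProduct.assoc K _ _ _).symm (f ⊗ₜ T)) ((a, w), b) =
          (wordBasis K _).repr f a * (pairBasis K _ _).repr T (w, b) := by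
        intro T
        induction T with
        | zero => simp
        | add p q hp hq =>
          simp only [TensorProduct.tmul_add, map_add, Finsupp.add_apply, hp, hq, mul_add]
        | tmul g g' =>
          simp only [TensorProduct.assoc_symm_tmul, B, Module.Basis.tensorProduct_repr_tmul_apply,
            pairBasis_repr_tmul, smul_eq_mul]
          ring
      rw [e, repr_theta, mul_ite, mul_zero]
  -- Compare coefficients at `((a, w), b')`, where `w` pairs the first indices of `b` with `0`, and
  -- `b'` is `b` with its first indices replaced by `0`. The inner indices of `w` and `b'` match and
  -- recombine to `b`, so the right side is `c (a, b)`. The left side vanishes unless `a` and `b`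
  -- match, and otherwise has all its inner indices equal to `0`.
  have hcc : ∀ a b, c (a, b) = if a.map Prod.snd = b.map Prod.fst then
      c ((a.map Prod.fst).zip (b.map fun _ => ⟨0, ht⟩), b.map fun p => (⟨0, ht⟩, p.2)) else 0 := by
    intro a b
    have h1 := hl a (b.map fun p => (p.1, ⟨0, ht⟩)) (b.map fun p => (⟨0, ht⟩, p.2))
    rw [hx, hr] at h1
    simpa [Function.comp_def, List.zip_map'] using h1
  let φ : List (Fin m × Fin n) → List (Fin m × Fin t) × List (Fin t × Fin n) := fun w =>
    (w.map fun p => (p.1, ⟨0, ht⟩), w.map fun p => (⟨0, ht⟩, p.2))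
  have hφ : Function.Injective φ := by
    intro w w' h
    have h1 := congrArg (fun q => (q.1.map Prod.fst).zip (q.2.map Prod.snd)) h
    simpa [φ, Function.comp_def, List.zip_map'] using h1
  -- The preimage takes its coefficients from those of `x` at inner indices `0`, which determine all
  -- others by `hcc`.
  refine ⟨(wordBasis K _).repr.symm (c.comapDomain φ hφ.injOn), ?_⟩
  refine (pairBasis K _ _).repr.injective (Finsupp.ext fun ⟨a, b⟩ => ?_)
  rw [repr_theta, LinearEquiv.apply_symm_apply, ← hc, hcc]
  refine if_ctx_congr Iff.rfl (fun h => ?_) fun _ => rfl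
  -- Matching inner indices force equal lengths, so `zip` truncates nothing.
  have hlen : a.length = b.length := by simpa using congrArg List.length h
  rw [Finsupp.comapDomain_apply]
  congr 1
  refine Prod.ext ?_ ?_
  · simp only [φ]
    rw [show (fun p : Fin m × Fin n => (p.1, (⟨0, ht⟩ : Fin t))) =
      Prod.map id fun _ => ⟨0, ht⟩ from rfl, ← List.zip_map_right, List.map_map]
    rfl
  · simp only [φ]
    rw [show ∀ l : List (Fin m × Fin n), l.map (fun p => ((⟨0, ht⟩ : Fin t), p.2)) =
      (l.map Prod.snd).map fun j => (⟨0, ht⟩, j) from fun l => by simp,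
      List.map_snd_zip (by simp [hlen])]
    simp

end Coefficients

/-! ### From coinvariants to the cotensor product. -/

section Cotensor

variable {K : Type*} [Field K] {H : Type*} [Semiring H] [HopfAlgebra K H]

section

variable {A : Type*} [Semiring A] [Algebra K A]

/-- The map `a ⊗ h ↦ ρ(a) (1 ⊗ S(h))`. -/
def mulAntipode (ρ : A →ₐ[K] A ⊗[K] H) : A ⊗[K] H →ₗ[K] A ⊗[K] H :=
  LinearMap.mul' K (A ⊗[K] H) ∘ₗ TensorProduct.map ρ.toLinearMap
    ((Algebra.TensorProduct.includeRight (R := K) (A := A) (B := H)).toLinearMap ∘ₗ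
      HopfAlgebra.antipode K (A := H))

theorem mulAntipode_tmul (ρ : A →ₐ[K] A ⊗[K] H) (a : A) (h : H) :
    mulAntipode ρ (a ⊗ₜ h) = ρ a * (1 ⊗ₜ HopfAlgebra.antipode K h) := by
  simp [mulAntipode]

/-- As `S` reverses products, the contribution of `q` sits between `ρ a` and `1 ⊗ S(h)`. Being `c ⊗
1`, it commutes with `1 ⊗ S(h)` and comes out on the right. This reduces the identity `a₍₀₎ ⊗ a₍₁₎
S(a₍₂₎) = a ⊗ 1` to generators. -/
theorem mulAntipode_mul (ρ : A →ₐ[K] A ⊗[K] H) (p q : A ⊗[K] H) (c : A)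
    (hq : mulAntipode ρ q = c ⊗ₜ 1) : mulAntipode ρ (p * q) = mulAntipode ρ p * (c ⊗ₜ 1) := by
  induction p with
  | zero => simp
  | add p p' h h' => rw [add_mul, map_add, map_add, h, h', add_mul]
  | tmul a h =>
    have : mulAntipode ρ ((a ⊗ₜ h) * q) =
        ρ a * mulAntipode ρ q * (1 ⊗ₜ HopfAlgebra.antipode K h) := by
      clear hq
      induction q with
      | zero => simp
      | add p p' h h' => rw [mul_add, map_add, map_add, h, h', mul_add, add_mul]
      | tmul b g =>
        simp [mulAntipode_tmul, HopfAlgebra.antipode_mul_antidistrib, mul_assoc]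
    rw [this, hq, mulAntipode_tmul, mul_assoc, mul_assoc]
    simp

variable {B : Type*} [Semiring B] [Algebra K B]

/-- The map `h ⊗ (a ⊗ b) ↦ ρ(a) (1 ⊗ h) ⊗ b`. -/
def mulCoaction (B : Type*) [Semiring B] [Algebra K B] (ρ : A →ₐ[K] A ⊗[K] H) :
    H ⊗[K] (A ⊗[K] B) →ₗ[K] (A ⊗[K] H) ⊗[K] B :=
  (LinearMap.mul' K (A ⊗[K] H) ∘ₗ TensorProduct.map ρ.toLinearMap
    (Algebra.TensorProduct.includeRight (R := K) (A := A) (B := H)).toLinearMap).rTensor B ∘ₗ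
  (TensorProduct.assoc K A H B).symm.toLinearMap ∘ₗ
  (TensorProduct.leftComm K H A B).toLinearMap

theorem mulCoaction_tmul (ρ : A →ₐ[K] A ⊗[K] H) (h : H) (a : A) (b : B) :
    mulCoaction B ρ (h ⊗ₜ (a ⊗ₜ b)) = (ρ a * (1 ⊗ₜ h)) ⊗ₜ b := by
  simp [mulCoaction]

theorem mulCoaction_pairAux (ρ : A →ₐ[K] A ⊗[K] H) (p : A ⊗[K] H) (g : H) (b : B) :
    mulCoaction B ρ (pairAux K H A B (p ⊗ₜ (g ⊗ₜ b))) = (mulAntipode ρ p * (1 ⊗ₜ g)) ⊗ₜ b := by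
  induction p with
  | zero => simp
  | add p p' h h' => simp only [TensorProduct.add_tmul, map_add, h, h', add_mul]
  | tmul a h => simp [pairAux_tmul, mulCoaction_tmul, mulAntipode_tmul, mul_assoc]

/-- Coinvariants are in the cotensor product. -/
theorem rTensor_eq_of_mem_coinvariantAlgebra (ρ : A →ₐ[K] A ⊗[K] H) (l : B →ₐ[K] H ⊗[K] B)
    (hρ : ∀ a, mulAntipode ρ (ρ a) = a ⊗ₜ 1) (x : A ⊗[K] B) (hx : x ∈ coinvariantAlgebra ρ l) :
    ρ.toLinearMap.rTensor B x =
      (TensorProduct.assoc K A H B).symm (l.toLinearMap.lTensor A x) := by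
  have h1 : ∀ x : A ⊗[K] B, mulCoaction B ρ (1 ⊗ₜ x) = ρ.toLinearMap.rTensor B x := by
    intro x
    induction x with
    | zero => simp
    | add p q hp hq => simp only [TensorProduct.tmul_add, map_add, hp, hq]
    | tmul a b => simp [mulCoaction_tmul, ← Algebra.TensorProduct.one_def]
  -- Here `a₍₀₎ ⊗ a₍₁₎ S(a₍₂₎) b₍₋₁₎ ⊗ b₍₀₎` collapses to `a ⊗ b₍₋₁₎ ⊗ b₍₀₎` by `hρ`.
  have h2 : ∀ x : A ⊗[K] B, mulCoaction B ρ (pairCoaction ρ l x) =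
      (TensorProduct.assoc K A H B).symm (l.toLinearMap.lTensor A x) := by
    intro x
    induction x with
    | zero => simp
    | add p q hp hq => simp only [map_add, hp, hq]
    | tmul a b =>
      rw [pairCoaction_tmul, LinearMap.lTensor_tmul, AlgHom.toLinearMap_apply]
      -- Both sides are additive in `l b`, so it may be replaced by an arbitrary element of `H ⊗ B`,
      -- and then by a pure tensor.
      induction l b with
      | zero => simp
      | add p q hp hq => simp only [TensorProduct.tmul_add, map_add, hp, hq]
      | tmul g b => simp [mulCoaction_pairAux, hρ]
  rw [mem_coinvariantAlgebra] at hx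
  rw [← h1, ← h2, hx]

end

variable {t : ℕ}

theorem mulAntipode_rightCoaction (m : ℕ) {u : Matrix (Fin t) (Fin t) H}
    (hu : IsMultiplicative (K := K) u) (a : FreeMat K m t) :
    mulAntipode (rightCoaction m u) (rightCoaction m u a) = a ⊗ₜ 1 := by
  have hS : ∀ i j, ∑ k, u i k * HopfAlgebra.antipode K (u k j) = if i = j then 1 else 0 := by
    intro i j
    have h := HopfAlgebra.mul_antipode_lTensor_comul_apply (R := K) (u i j)
    rw [hu.comul_eq, hu.counit_eq] at h
    simp only [map_sum, LinearMap.lTensor_tmul, LinearMap.mul'_apply] at h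
    rw [h]
    split_ifs <;> simp
  induction a using FreeAlgebra.induction with
  | grade0 r =>
    rw [AlgHom.commutes, Algebra.TensorProduct.algebraMap_apply, mulAntipode_tmul,
      AlgHom.commutes]
    simp
  | mul a b ha hb => rw [map_mul, mulAntipode_mul _ _ _ _ hb, ha]; simp
  | add a b ha hb => rw [map_add, map_add, ha, hb, TensorProduct.add_tmul]
  | grade1 p =>
    obtain ⟨i, j⟩ := p
    simp only [rightCoaction, gen, FreeAlgebra.lift_ι_apply, map_sum, mulAntipode_tmul,
      Finset.sum_mul, Algebra.TensorProduct.tmul_mul_tmul, mul_one]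
    rw [Finset.sum_comm]
    simp only [← TensorProduct.tmul_sum, hS, TensorProduct.tmul_ite]
    simp

end Cotensor

-- On generators, the coactions of `H(F)` are `theta` for `A(t,t)` followed by `freeToH`. Since
-- `freeToH` stays injective after tensoring over `K`, the cotensor condition descends from `H(F)`
-- to `A(t,t)`.
open CosovH in
theorem mem_range_theta_of_coinvariant {K : Type*} [Field K] {m n t : ℕ} (ht : 0 < t)
    (F : Matrix.GeneralLinearGroup (Fin t) K) (x : FreeMat K m t ⊗[K] FreeMat K t n)
    (hx : x ∈ coinvariantAlgebra (rightCoaction (K := K) m (U F)) (leftCoaction n (U F))) :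
    x ∈ Set.range (theta K m n t) := by
  refine mem_range_theta K ht x ?_
  have h := rTensor_eq_of_mem_coinvariantAlgebra _ _
    (mulAntipode_rightCoaction m (isMultiplicative_U F)) x hx
  have hρ : rightCoaction (K := K) m (U F) =
      (Algebra.TensorProduct.map (AlgHom.id K _) (freeToH F)).comp (theta K m t t) := by
    refine FreeAlgebra.hom_ext (funext fun p => ?_)
    simp [rightCoaction, theta, gen, freeToH]
  have hl : leftCoaction (K := K) n (U F) =
      (Algebra.TensorProduct.map (freeToH F) (AlgHom.id K _)).comp (theta K t n t) := by
    refine FreeAlgebra.hom_ext (funext fun p => ?_)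
    simp [leftCoaction, theta, gen, freeToH]
  have hinj : Function.Injective (((freeToH F).toLinearMap.lTensor (FreeMat K m t)).rTensor
      (FreeMat K t n)) :=
    Module.Flat.rTensor_preserves_injective_linearMap _
      (Module.Flat.lTensor_preserves_injective_linearMap _ (freeToH_injective F))
  apply hinj
  convert h using 1
  · rw [hρ, ← LinearMap.comp_apply, ← LinearMap.rTensor_comp]
    rfl
  · rw [hl]
    clear h hx
    induction x with
    | zero => simp
    | add p q hp hq => simp only [map_add, hp, hq]
    | tmul a b =>
      simp only [LinearMap.lTensor_tmul, AlgHom.toLinearMap_apply, AlgHom.comp_apply]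
      induction theta K t n t b with
      | zero => simp
      | add p q hp hq => simp only [TensorProduct.tmul_add, map_add, hp, hq]
      | tmul g b => simp

end FreeFFT
end

theorem theorem2p1 {K : Type*} [Field K] (m n t : ℕ) (hm : 0 < m) (hn : 0 < n) (ht : 0 < t)
    (F : Matrix.GeneralLinearGroup (Fin t) K) :
    Function.Bijective
      (FreeFFT.thetaCo m n (FreeFFT.CosovH.isMultiplicative_U F) :
        FreeFFT.FreeMat K m n →ₐ[K]
          FreeFFT.coinvariantAlgebra
            (FreeFFT.rightCoaction (K := K) m (FreeFFT.CosovH.U F))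
            (FreeFFT.leftCoaction n (FreeFFT.CosovH.U F))) := by
  constructor
  · intro f g h
    exact FreeFFT.theta_injective K ht (congrArg Subtype.val h)
  · rintro ⟨x, hx⟩
    obtain ⟨f, rfl⟩ := FreeFFT.mem_range_theta_of_coinvariant ht F x hx
    exact ⟨f, rfl⟩
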